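/- Let $C(2^{\mathbb N})$ be the Banach space of continuous real functions on the Cantor set, and let $\mathbf{SB}$ be the set of its closed linear subspaces with the Effros--Borel $\sigma$-algebra, i.e. the one generated by the sets $\{X : X\cap U\neq\emptyset\}$ with $U\subset C(2^{\mathbb N})$ open. Fix any sequence $(d_n)_{n\ge 1}$ of Borel functions $d_n:\mathbf{SB}\to C(2^{\mathbb N})$ such that $\{d_n(X):n\in\mathbb N\}$ is a dense subset of $X$ for every $X\in\mathbf{SB}$ (such sequences exist). Let $\mathcal L$ be the set of all triples $(X,Y,(y_n)_{n\ge1})\in \mathbf{SB}\times\mathbf{SB}\times C(2^{\mathbb N})^{\mathbb N}$ such that $y_n\in Y$ for all $n$ and there is $k\in\mathbb N$ with $$\Big\|\sum_{i=1}^n q_i y_i\Big\|\le k\Big\|\sum_{i=1}^n q_i d_i(X)\Big\|\qquad\text{for all } n\in\mathbb N,\ q_1,\dots,q_n\in\mathbb Q,$$ with the $\sigma$-algebra induced by the product Borel $\sigma$-algebra; it is a standard Borel space. The triple $(X,Y,(y_n))$ is identified with the unique bounded linear operator $A:X\to Y$ such that $A\,d_n(X)=y_n$ for all $n$; in this way $\mathcal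 L$ codes the bounded linear operators between separable Banach spaces. An operator $A:X\to Y$ *factors through* $B:Z\to W$ if $A=DBC$ for some bounded linear operators $C:X\to Z$ and $D:W\to Y$. It *factors through a restriction of* $B$ if there are closed subspaces $Z_1\subset Z$ and $W_1\subset W$ with $B(Z_1)\subset W_1$ such that $A$ factors through $B|_{Z_1}:Z_1\to W_1$. A subset of a standard Borel space $S$ is *analytic* if it is the image of a Borel subset of a standard Borel space $S'$ under a Borel map $S'\to S$. Let $\mathcal B\subset\mathcal L$ be Borel. Then each of the following subsets of $\mathcal L$ is analytic: 1. the set of all $A\in\mathcal L$ that factor through some $B\in\mathcal B$; 2. the set of all $A\in\mathcal L$ such that some $B\in\mathcal B$ factors through $A$; 3. the set of all $A\in\mathcal L$ such that some $B\in\mathcal B$ factors through a restriction of $A$; 4. the set of all $A\in\mathcal L$ that factor through a restriction of some $B\in\mathcal B$. -/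

import Mathlib

open MeasureTheory Set Filter Topology

noncomputable section

/-- A subset of a standard Borel space is analytic if it is the Borel image of a Borel subset of a
standard Borel space. -/
def IsAnalytic {S : Type} [MeasurableSpace S] [StandardBorelSpace S] (A : Set S) : Prop :=
  ∃ (S' : Type) (_ : MeasurableSpace S') (_ : StandardBorelSpace S') (B : Set S') (f : S' → S),
    MeasurableSet B ∧ Measurable f ∧ f '' B = A

section Factorization

variable {X Y Z W : Type*}
  [NormedAddCommGroup X] [NormedSpace ℝ X] [NormedAddCommGroup Y] [NormedSpace ℝ Y]
  [NormedAddCommGroup Z] [NormedSpace ℝ Z] [NormedAddCommGroup W] [NormedSpace ℝ W]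

/-- `A : X → Y` factors through `B : Z → W` if `A = D B C` for some operators
`C : X → Z` and `D : W → Y`. -/
def FactorsThrough (A : X →L[ℝ] Y) (B : Z →L[ℝ] W) : Prop :=
  ∃ (C : X →L[ℝ] Z) (D : W →L[ℝ] Y), A = D.comp (B.comp C)

/-- `A : X → Y` factors through a restriction of `B : Z → W` if there are closed subspaces `Z₁` of
`Z` and `W₁` of `W` with `B Z₁ ⊆ W₁` such that `A` factors through `B|_{Z₁} : Z₁ → W₁`. -/
def FactorsThroughRestriction (A : X →L[ℝ] Y) (B : Z →L[ℝ] W) : Prop :=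
  ∃ (Z₁ : ClosedSubmodule ℝ Z) (W₁ : ClosedSubmodule ℝ W)
    (h : ∀ z ∈ Z₁.toSubmodule, B z ∈ W₁.toSubmodule), FactorsThrough A (B.restrict h)

end Factorization

/-- An assignment `x_n ↦ y_n` on a dense sequence which is bounded on linear combinations extends
uniquely to a bounded linear operator. -/
theorem existsUnique_extension {E F : Type*} [NormedAddCommGroup E] [NormedSpace ℝ E]
    [NormedAddCommGroup F] [NormedSpace ℝ F] [CompleteSpace F] (x : ℕ → E) (y : ℕ → F)
    (hx : DenseRange x) (k : ℝ) (hk : ∀ (n : ℕ) (a : ℕ → ℝ),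
      ‖∑ i ∈ Finset.range n, a i • y i‖ ≤ k * ‖∑ i ∈ Finset.range n, a i • x i‖) :
    ∃! A : E →L[ℝ] F, ∀ n, A (x n) = y n := by
  have hed : DenseRange (Finsupp.linearCombination ℝ x) := by
    refine hx.mono ?_
    rintro _ ⟨n, rfl⟩
    exact ⟨Finsupp.single n 1, by simp⟩
  have hb : ∃ C : ℝ, ∀ c, ‖Finsupp.linearCombination ℝ y c‖ ≤
      C * ‖Finsupp.linearCombination ℝ x c‖ := by
    refine ⟨k, fun c => ?_⟩
    obtain ⟨n, hn⟩ : ∃ n, c.support ⊆ Finset.range n := c.support.exists_nat_subset_range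
    have h1 : Finsupp.linearCombination ℝ y c = ∑ i ∈ Finset.range n, c i • y i := by
      rw [Finsupp.linearCombination_apply]
      exact Finsupp.sum_of_support_subset _ hn _ (by simp)
    have h2 : Finsupp.linearCombination ℝ x c = ∑ i ∈ Finset.range n, c i • x i := by
      rw [Finsupp.linearCombination_apply]
      exact Finsupp.sum_of_support_subset _ hn _ (by simp)
    rw [h1, h2]
    exact hk n c
  have hA : ∀ n, (Finsupp.linearCombination ℝ y).extendOfNorm (Finsupp.linearCombination ℝ x) (x n)
      = y n := by
    intro n
    have := LinearMap.extendOfNorm_eq hed hb (Finsupp.single n 1)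
    simpa only [Finsupp.linearCombination_single, one_smul] using this
  refine ⟨_, hA, fun B hB => ContinuousLinearMap.ext fun z => ?_⟩
  refine congrFun (hx.equalizer B.continuous (ContinuousLinearMap.continuous _) ?_) z
  funext n
  exact (hB n).trans (hA n).symm

/-- The space `C(2^ℕ)` of continuous real functions on the Cantor set. -/
abbrev CantorC : Type := C(ℕ → Bool, ℝ)

instance CantorC.instMeasurableSpace : MeasurableSpace CantorC := borel CantorC

instance CantorC.instBorelSpace : BorelSpace CantorC := ⟨rfl⟩

instance CantorC.instPolishSpace : PolishSpace CantorC := inferInstance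

/-- The set `SB` of closed linear subspaces of `C(2^ℕ)`. -/
abbrev SB : Type := ClosedSubmodule ℝ CantorC

/-- The Effros-Borel structure on `SB`. -/
instance SB.instMeasurableSpace : MeasurableSpace SB :=
  MeasurableSpace.generateFrom
    {s | ∃ U : Set CantorC, IsOpen U ∧ s = {X : SB | ((X : Set CantorC) ∩ U).Nonempty}}

/-- A sequence `d₀, d₁, …` of Borel functions `SB → C(2^ℕ)` such that `{d_n(X) : n}` is a dense
subset of `X` for every `X`. -/
structure DenseSelection where
  d : ℕ → SB → CantorC
  measurable_d : ∀ n, Measurable (d n)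
  d_mem : ∀ n (X : SB), d n X ∈ X
  dense_d : ∀ X : SB, (X : Set CantorC) ⊆ closure (range fun n => d n X)

/-- The space `𝓛` of codes `(X, Y, (y_n))` of operators between separable Banach spaces, relative
to the dense selection `σ`. It carries the σ-algebra induced by the product σ-algebra. -/
def OperatorCode (σ : DenseSelection) : Type :=
  {T : SB × SB × (ℕ → CantorC) //
    (∀ n, T.2.2 n ∈ T.2.1) ∧
    ∃ k : ℕ, ∀ (n : ℕ) (q : ℕ → ℚ),
      ‖∑ i ∈ Finset.range n, (q i : ℝ) • T.2.2 i‖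
        ≤ k * ‖∑ i ∈ Finset.range n, (q i : ℝ) • σ.d i T.1‖}

instance OperatorCode.instMeasurableSpace (σ : DenseSelection) :
    MeasurableSpace (OperatorCode σ) :=
  Subtype.instMeasurableSpace

namespace OperatorCode

variable {σ : DenseSelection}

/-- The domain. -/
def dom (T : OperatorCode σ) : SB := T.1.1

/-- The codomain. -/
def cod (T : OperatorCode σ) : SB := T.1.2.1

/-- The sequence `(y_n)`. -/
def seq (T : OperatorCode σ) : ℕ → CantorC := T.1.2.2

theorem seq_mem (T : OperatorCode σ) (n : ℕ) : T.seq n ∈ T.cod := T.2.1 n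

/-- The norm estimate passes from rational to real coefficients. -/
theorem exists_bound (T : OperatorCode σ) :
    ∃ k : ℕ, ∀ (n : ℕ) (a : ℕ → ℝ),
      ‖∑ i ∈ Finset.range n, a i • T.seq i‖
        ≤ k * ‖∑ i ∈ Finset.range n, a i • σ.d i T.dom‖ := by
  obtain ⟨k, hk⟩ := T.2.2
  refine ⟨k, fun n a => ?_⟩
  have hd : DenseRange (fun (q : ℕ → ℚ) (i : ℕ) => (q i : ℝ)) :=
    DenseRange.piMap (f := fun _ : ℕ => ((↑) : ℚ → ℝ)) fun _ => Rat.denseRange_cast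
  refine hd.induction_on (p := fun a : ℕ → ℝ =>
      ‖∑ i ∈ Finset.range n, a i • T.seq i‖
        ≤ k * ‖∑ i ∈ Finset.range n, a i • σ.d i T.dom‖) a ?_ (fun q => hk n q)
  exact isClosed_le (by fun_prop) (by fun_prop)

/-- A code determines a unique operator `A : X → Y` with `A d_n(X) = y_n`. -/
theorem existsUnique_op (T : OperatorCode σ) :
    ∃! A : T.dom.toSubmodule →L[ℝ] T.cod.toSubmodule,
      ∀ n, (A ⟨σ.d n T.dom, σ.d_mem n T.dom⟩ : CantorC) = T.seq n := by
  have : CompleteSpace T.cod.toSubmodule := T.cod.isClosed.completeSpace_coe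
  obtain ⟨k, hk⟩ := T.exists_bound
  have hxd : DenseRange fun n => (⟨σ.d n T.dom, σ.d_mem n T.dom⟩ : T.dom.toSubmodule) := by
    intro z
    rw [closure_subtype, ← range_comp]
    exact σ.dense_d T.dom z.2
  obtain ⟨A, hA, hu⟩ := existsUnique_extension _
    (fun n => (⟨T.seq n, T.seq_mem n⟩ : T.cod.toSubmodule)) hxd k (fun n a => by
      have e (S : SB) (z : ℕ → S.toSubmodule) : ‖∑ i ∈ Finset.range n, a i • z i‖ =
          ‖∑ i ∈ Finset.range n, a i • (z i : CantorC)‖ := by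
        change ‖((∑ i ∈ Finset.range n, a i • z i : S.toSubmodule) : CantorC)‖ = _
        rw [Submodule.coe_sum]
        rfl
      have h := hk n a
      exact (e T.cod fun i => ⟨T.seq i, T.seq_mem i⟩).trans_le (h.trans_eq (congrArg ((k : ℝ) * ·)
        (e T.dom fun i => ⟨σ.d i T.dom, σ.d_mem i T.dom⟩).symm)))
  exact ⟨A, fun n => congrArg Subtype.val (hA n), fun B hB => hu B fun n => Subtype.ext (hB n)⟩

/-- The operator `A : X → Y` coded by `(X, Y, (y_n))`: the one with `A d_n(X) = y_n`. -/
def op (T : OperatorCode σ) : T.dom.toSubmodule →L[ℝ] T.cod.toSubmodule :=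
  T.existsUnique_op.choose

theorem op_apply (T : OperatorCode σ) (n : ℕ) :
    (T.op ⟨σ.d n T.dom, σ.d_mem n T.dom⟩ : CantorC) = T.seq n :=
  T.existsUnique_op.choose_spec.1 n

end OperatorCode

/-- Borel selections exist (Kuratowski and Ryll-Nardzewski). -/
theorem exists_measurable_selection {Ω E : Type*} [MeasurableSpace Ω] [MetricSpace E]
    [CompleteSpace E] [SecondCountableTopology E] [Nonempty E] [MeasurableSpace E] [BorelSpace E]
    (Φ : Ω → Set E) (hne : ∀ X, (Φ X).Nonempty)
    (hm : ∀ U, IsOpen U → MeasurableSet {X | (Φ X ∩ U).Nonempty}) :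
    ∃ f : Ω → E, Measurable f ∧ ∀ X, f X ∈ closure (Φ X) := by
  classical
  let u := TopologicalSpace.denseSeq E
  have hu : DenseRange u := TopologicalSpace.denseRange_denseSeq E
  let G (n : ℕ) : Type _ :=
    {f : Ω → E // Measurable f ∧ ∀ X, (Φ X ∩ Metric.ball (f X) ((1 / 2 : ℝ) ^ n)).Nonempty}
  have pos (n : ℕ) : (0 : ℝ) < (1 / 2 : ℝ) ^ n := by positivity
  have h0 : Nonempty (G 0) := by
    have hp : ∀ X, ∃ k, (Φ X ∩ Metric.ball (u k) ((1 / 2 : ℝ) ^ 0)).Nonempty := by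
      intro X
      obtain ⟨z, hz⟩ := hne X
      obtain ⟨k, hk⟩ := hu.exists_dist_lt z (pos 0)
      exact ⟨k, z, hz, hk⟩
    exact ⟨⟨fun X => u (Nat.find (hp X)),
      measurable_from_nat.comp (measurable_find hp fun k => hm _ Metric.isOpen_ball),
      fun X => Nat.find_spec (hp X)⟩⟩
  have hs : ∀ n (f : G n), ∃ g : G (n + 1), ∀ X, dist (f.1 X) (g.1 X) ≤ 2 * (1 / 2 : ℝ) ^ n := by
    rintro n ⟨f, hf, hfΦ⟩
    have hp : ∀ X, ∃ k, (Φ X ∩ Metric.ball (u k) ((1 / 2 : ℝ) ^ (n + 1))).Nonempty ∧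
        dist (f X) (u k) < 2 * (1 / 2 : ℝ) ^ n := by
      intro X
      obtain ⟨z, hz, hzf⟩ := hfΦ X
      obtain ⟨k, hk⟩ := hu.exists_dist_lt z (pos (n + 1))
      refine ⟨k, ⟨z, hz, hk⟩, ?_⟩
      have h1 := dist_triangle (f X) z (u k)
      rw [Metric.mem_ball, dist_comm] at hzf
      have h2 : (1 / 2 : ℝ) ^ (n + 1) ≤ (1 / 2 : ℝ) ^ n := by
        rw [pow_succ]; linarith [pos n]
      linarith
    refine ⟨⟨fun X => u (Nat.find (hp X)), measurable_from_nat.comp (measurable_find hp fun k =>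
      (hm _ Metric.isOpen_ball).inter (measurableSet_lt (hf.dist measurable_const)
        measurable_const)), fun X => (Nat.find_spec (hp X)).1⟩,
      fun X => (Nat.find_spec (hp X)).2.le⟩
  choose S hS using hs
  let F (n : ℕ) : G n := Nat.rec (Classical.choice h0) (fun n f => S n f) n
  have hF (n : ℕ) (X : Ω) : dist ((F n).1 X) ((F (n + 1)).1 X) ≤ 2 * (1 / 2 : ℝ) ^ n :=
    hS n (F n) X
  have hlim : ∀ X, ∃ l, Tendsto (fun n => (F n).1 X) atTop (𝓝 l) := fun X =>
    cauchySeq_tendsto_of_complete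
      (cauchySeq_of_le_geometric (1 / 2) 2 (by norm_num) fun n => hF n X)
  choose f hf using hlim
  refine ⟨f, measurable_of_tendsto_metrizable (fun n => (F n).2.1) (tendsto_pi_nhds.2 hf),
    fun X => ?_⟩
  choose z hz hzd using fun n => (F n).2.2 X
  refine mem_closure_of_tendsto (f := z) (b := atTop) ?_ (Eventually.of_forall hz)
  refine tendsto_of_tendsto_of_dist (hf X) ?_
  refine squeeze_zero (fun n => dist_nonneg) (fun n => ?_)
    (tendsto_pow_atTop_nhds_zero_of_lt_one (r := (1 / 2 : ℝ)) (by norm_num) (by norm_num))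
  rw [dist_comm]
  exact (hzd n).le

theorem SB.measurableSet_meets {U : Set CantorC} (hU : IsOpen U) :
    MeasurableSet {X : SB | ((X : Set CantorC) ∩ U).Nonempty} :=
  MeasurableSpace.measurableSet_generateFrom ⟨U, hU, rfl⟩

instance DenseSelection.instNonempty : Nonempty DenseSelection := by
  classical
  let u := TopologicalSpace.denseSeq CantorC
  have hu : DenseRange u := TopologicalSpace.denseRange_denseSeq CantorC
  have key : ∀ p : ℕ × ℕ, ∃ f : SB → CantorC, Measurable f ∧ (∀ X : SB, f X ∈ X) ∧
      ∀ X : SB, ((X : Set CantorC) ∩ Metric.ball (u p.1) (1 / (p.2 + 1))).Nonempty →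
        dist (f X) (u p.1) ≤ 1 / (p.2 + 1) := by
    intro p
    set V := Metric.ball (u p.1) (1 / ((p.2 : ℝ) + 1)) with hV
    have hVo : IsOpen V := Metric.isOpen_ball
    let Φ : SB → Set CantorC := fun X =>
      if ((X : Set CantorC) ∩ V).Nonempty then (X : Set CantorC) ∩ V else X
    have hΦ : ∀ X, Φ X ⊆ X := by
      intro X
      simp only [Φ]
      split_ifs
      exacts [inter_subset_left, subset_rfl]
    obtain ⟨f, hf, hfm⟩ := exists_measurable_selection Φ (by
      intro X
      simp only [Φ]
      split_ifs with h
      exacts [h, ⟨0, X.zero_mem⟩]) (by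
      intro U hU
      have : {X : SB | (Φ X ∩ U).Nonempty} =
          {X : SB | ((X : Set CantorC) ∩ (V ∩ U)).Nonempty} ∪
          ({X : SB | ((X : Set CantorC) ∩ V).Nonempty}ᶜ ∩
            {X : SB | ((X : Set CantorC) ∩ U).Nonempty}) := by
        ext X
        by_cases h : ((X : Set CantorC) ∩ V).Nonempty
        · simp [Φ, h, inter_assoc]
        · have h' : ¬ ((X : Set CantorC) ∩ (V ∩ U)).Nonempty := fun ⟨z, hz⟩ =>
            h ⟨z, hz.1, hz.2.1⟩
          simp [Φ, h, h']
      rw [this]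
      exact (SB.measurableSet_meets (hVo.inter hU)).union
        ((SB.measurableSet_meets hVo).compl.inter (SB.measurableSet_meets hU)))
    refine ⟨f, hf, fun X => ?_, fun X hX => ?_⟩
    · exact X.isClosed.closure_subset_iff.2 (hΦ X) (hfm X)
    · have h1 : Φ X ⊆ Metric.closedBall (u p.1) (1 / ((p.2 : ℝ) + 1)) := by
        simp only [Φ, if_pos hX]
        exact inter_subset_right.trans Metric.ball_subset_closedBall
      exact Metric.isClosed_closedBall.closure_subset_iff.2 h1 (hfm X)
  choose f hf hfm hfd using key
  refine ⟨⟨fun n => f n.unpair, fun n => hf _, fun n X => hfm _ X, fun X x hx => ?_⟩⟩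
  rw [Metric.mem_closure_iff]
  intro ε hε
  obtain ⟨j, hj⟩ := exists_nat_one_div_lt (half_pos hε)
  obtain ⟨k, hk⟩ := hu.exists_dist_lt x (ε := 1 / ((j : ℝ) + 1)) (by positivity)
  refine ⟨_, ⟨Nat.pair k j, rfl⟩, ?_⟩
  have h1 := hfd (k, j) X ⟨x, hx, hk⟩
  have h2 := dist_triangle x (u k) (f (k, j) X)
  rw [dist_comm] at h1
  simp only [Nat.unpair_pair]
  simp only at h1
  linarith

/-- The closed linear span is a Borel function of the sequence. -/
theorem SB.measurable_closedSpan :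
    Measurable fun x : ℕ → CantorC => (Submodule.span ℝ (range x)).closure := by
  refine measurable_generateFrom ?_
  rintro _ ⟨U, hU, rfl⟩
  have : (fun x : ℕ → CantorC => (Submodule.span ℝ (range x)).closure) ⁻¹'
      {X : SB | ((X : Set CantorC) ∩ U).Nonempty} =
      ⋃ c : ℕ →₀ ℝ, {x | (c.sum fun i a => a • x i) ∈ U} := by
    ext x
    have h : ((Submodule.span ℝ (range x)).closure : Set CantorC) =
      closure (Submodule.span ℝ (range x) : Set CantorC) := rfl
    simp only [mem_preimage, mem_ofPred_eq, mem_iUnion, h, inter_comm _ U]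
    rw [inter_comm, closure_inter_open_nonempty_iff hU]
    constructor
    · rintro ⟨z, hz, hzU⟩
      obtain ⟨c, rfl⟩ := Finsupp.mem_span_range_iff_exists_finsupp.1 hz
      exact ⟨c, hzU⟩
    · rintro ⟨c, hc⟩
      exact ⟨_, Finsupp.mem_span_range_iff_exists_finsupp.2 ⟨c, rfl⟩, hc⟩
  rw [this]
  refine (isOpen_iUnion fun c => hU.preimage ?_).measurableSet
  unfold Finsupp.sum
  fun_prop

theorem MeasurableEquiv.standardBorelSpace {α β : Type*} [MeasurableSpace α] [MeasurableSpace β]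
    [StandardBorelSpace β] (φ : α ≃ᵐ β) : StandardBorelSpace α := by
  let := upgradeStandardBorel β
  let : TopologicalSpace α := TopologicalSpace.induced φ inferInstance
  have : PolishSpace α := φ.toEquiv.polishSpace_induced
  have : BorelSpace α := ⟨by
    refine φ.measurableEmbedding.comap_eq.symm.trans ?_
    exact (congrArg (MeasurableSpace.comap ⇑φ) (eq_borel_upgradeStandardBorel β)).trans
      borel_comap.symm⟩
  infer_instance

instance SB.instStandardBorelSpace : StandardBorelSpace SB := by
  obtain ⟨σ⟩ := DenseSelection.instNonempty
  let s : (ℕ → CantorC) → SB := fun x => (Submodule.span ℝ (range x)).closure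
  have hs : Measurable s := SB.measurable_closedSpan
  let e : SB → ℕ → CantorC := fun X n => σ.d n X
  have he : Measurable e := measurable_pi_lambda _ σ.measurable_d
  have hse : ∀ X, s (e X) = X := by
    intro X
    refine SetLike.coe_injective (Subset.antisymm ?_ ?_)
    · refine X.isClosed.closure_subset_iff.2 ?_
      have : Submodule.span ℝ (range (e X)) ≤ X.toSubmodule := by
        rw [Submodule.span_le]
        rintro _ ⟨n, rfl⟩
        exact σ.d_mem n X
      exact this
    · exact (σ.dense_d X).trans (closure_mono Submodule.subset_span)
  let P : Set (ℕ → CantorC) := {x | e (s x) = x}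
  have hP : MeasurableSet P := measurableSet_eq_fun (he.comp hs) measurable_id
  have : StandardBorelSpace P := hP.standardBorel
  have heP : Measurable fun X => (⟨e X, congrArg e (hse X)⟩ : P) := he.subtype_mk
  have hsP : Measurable fun x : P => s x.1 := hs.comp measurable_subtype_coe
  let φ : SB ≃ᵐ P :=
    { toFun := fun X => ⟨e X, congrArg e (hse X)⟩
      invFun := fun x => s x.1
      left_inv := hse
      right_inv := fun x => Subtype.ext x.2
      measurable_toFun := heP
      measurable_invFun := hsP }
  exact φ.standardBorelSpace

theorem SB.measurableSet_mem : MeasurableSet {p : CantorC × SB | p.1 ∈ p.2} := by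
  obtain ⟨σ⟩ := DenseSelection.instNonempty
  have : {p : CantorC × SB | p.1 ∈ p.2} =
      ⋂ j : ℕ, ⋃ n : ℕ, {p | dist p.1 (σ.d n p.2) < 1 / ((j : ℝ) + 1)} := by
    ext ⟨x, X⟩
    simp only [mem_ofPred_eq, mem_iInter, mem_iUnion]
    constructor
    · intro h j
      obtain ⟨_, ⟨n, rfl⟩, hn⟩ := Metric.mem_closure_iff.1 (σ.dense_d X h) (1 / ((j : ℝ) + 1))
        (by positivity)
      exact ⟨n, hn⟩
    · intro h
      refine X.isClosed.closure_subset (Metric.mem_closure_iff.2 fun ε hε => ?_)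
      obtain ⟨j, hj⟩ := exists_nat_one_div_lt hε
      obtain ⟨n, hn⟩ := h j
      exact ⟨_, σ.d_mem n X, hn.trans hj⟩
  rw [this]
  exact .iInter fun j => .iUnion fun n => measurableSet_lt
    (measurable_fst.dist ((σ.measurable_d n).comp measurable_snd)) measurable_const

instance OperatorCode.instStandardBorelSpace (σ : DenseSelection) :
    StandardBorelSpace (OperatorCode σ) := by
  refine MeasurableSet.standardBorel (α := SB × SB × (ℕ → CantorC)) ?_
  refine MeasurableSet.inter (s₁ := {T : SB × SB × (ℕ → CantorC) | ∀ n, T.2.2 n ∈ T.2.1}) ?_ ?_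
  · rw [ofPred_forall]
    refine .iInter fun n => ?_
    exact SB.measurableSet_mem.preimage (f := fun T : SB × SB × (ℕ → CantorC) => (T.2.2 n, T.2.1))
      (by fun_prop)
  · have hσ := σ.measurable_d
    have : {T : SB × SB × (ℕ → CantorC) | ∃ k : ℕ, ∀ (n : ℕ) (q : ℕ → ℚ),
        ‖∑ i ∈ Finset.range n, (q i : ℝ) • T.2.2 i‖
          ≤ k * ‖∑ i ∈ Finset.range n, (q i : ℝ) • σ.d i T.1‖} =
        ⋃ k : ℕ, ⋂ n : ℕ, ⋂ q : Fin n → ℚ, {T : SB × SB × (ℕ → CantorC) |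
          ‖∑ i, (q i : ℝ) • T.2.2 i‖ ≤ k * ‖∑ i, (q i : ℝ) • σ.d i T.1‖} := by
      ext T
      simp only [mem_ofPred_eq, mem_iUnion, mem_iInter]
      refine exists_congr fun k => forall_congr' fun n => ⟨fun h q => ?_, fun h q => ?_⟩
      · have := h fun i => if hi : i < n then q ⟨i, hi⟩ else 0
        simpa [Finset.sum_range] using this
      · have := h fun i => q i
        rwa [Finset.sum_range, Finset.sum_range]
    change MeasurableSet {T : SB × SB × (ℕ → CantorC) | _}
    rw [this]
    refine .iUnion fun k => .iInter fun n => .iInter fun q => measurableSet_le ?_ ?_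
    · fun_prop
    · fun_prop

end

noncomputable section

/-! Every bounded operator between closed subspaces of `C(2^ℕ)` has a code, so the operators `C` and
`D` in a factorization `A = DBC` can be quantified over the standard Borel space of codes. If the
relation "`C` and `D` witness that `A` factors through `B`" is Borel, then each of the four sets is
a projection of a Borel set of quadruples `(A, B, C, D)`, hence analytic.

The relation is Borel because evaluation `(T, x) ↦ T x` is jointly Borel (`measurable_eval`), and
because continuity and density reduce the identity `A = DBC` to the vectors `d_n(X)`, that is, to
countably many conditions.

For restrictions, no quantifier over `Z₁` and `W₁` is needed. One may take `W₁` to be the domain of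
`D` and `Z₁` its full preimage under `B`; what remains is that `BC` maps each `d_n(X)` into that
domain. Thus `IsFactorization` describes factoring through a restriction, and the further equation
`D.dom = B.cod` describes factoring through `B` itself. -/

theorem ContinuousLinearMap.exists_nat_bound {E F : Type*} [NormedAddCommGroup E] [NormedSpace ℝ E]
    [NormedAddCommGroup F] [NormedSpace ℝ F] (f : E →L[ℝ] F) : ∃ k : ℕ, ∀ x, ‖f x‖ ≤ k * ‖x‖ :=
  (exists_nat_ge ‖f‖).imp fun _ hk x => f.le_of_opNorm_le hk x

/-! ### Codes of operators and their evaluation -/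

namespace OperatorCode

variable {σ : DenseSelection}

/-- The code of an operator between closed subspaces of `C(2^ℕ)`. -/
def ofCLM (σ : DenseSelection) {X Y : SB} (T : X.toSubmodule →L[ℝ] Y.toSubmodule) :
    OperatorCode σ :=
  ⟨(X, Y, fun n => (T ⟨σ.d n X, σ.d_mem n X⟩ : CantorC)), fun n => (T _).2, by
    obtain ⟨k, hk⟩ := ContinuousLinearMap.exists_nat_bound (E := X.toSubmodule)
      (F := Y.toSubmodule) T
    refine ⟨k, fun n q => ?_⟩
    let z : X.toSubmodule := ∑ i ∈ Finset.range n, (q i : ℝ) • ⟨σ.d i X, σ.d_mem i X⟩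
    have hz : (z : CantorC) = ∑ i ∈ Finset.range n, (q i : ℝ) • σ.d i X := by
      simp [z]
    have hTz : (T z : CantorC) =
        ∑ i ∈ Finset.range n, (q i : ℝ) • (T ⟨σ.d i X, σ.d_mem i X⟩ : CantorC) := by
      simp only [z, map_sum, map_smul, Submodule.coe_sum, Submodule.coe_smul]
    change ‖∑ i ∈ Finset.range n, (q i : ℝ) • (T ⟨σ.d i X, σ.d_mem i X⟩ : CantorC)‖
      ≤ k * ‖∑ i ∈ Finset.range n, (q i : ℝ) • σ.d i X‖
    rw [← hz, ← hTz]
    exact hk z⟩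

theorem op_ofCLM {X Y : SB} (T : X.toSubmodule →L[ℝ] Y.toSubmodule) : (ofCLM σ T).op = T :=
  (ofCLM σ T).existsUnique_op.unique (ofCLM σ T).op_apply fun _ => rfl

theorem denseRange_dom (σ : DenseSelection) (X : SB) :
    DenseRange fun n => (⟨σ.d n X, σ.d_mem n X⟩ : X.toSubmodule) := by
  intro z
  rw [closure_subtype, ← range_comp]
  exact σ.dense_d X z.2

open Classical in
/-- The value at `x` of the operator coded by `T`, and `0` if `x` is not in its domain. -/
def eval (T : OperatorCode σ) (x : CantorC) : CantorC :=
  if h : x ∈ T.dom.toSubmodule then T.op ⟨x, h⟩ else 0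

theorem eval_of_mem (T : OperatorCode σ) {x : CantorC} (h : x ∈ T.dom.toSubmodule) :
    T.eval x = T.op ⟨x, h⟩ := dif_pos h

theorem eval_coe (T : OperatorCode σ) (x : T.dom.toSubmodule) : T.eval x = T.op x := dif_pos x.2

theorem measurable_dom : Measurable (dom : OperatorCode σ → SB) :=
  measurable_fst.comp measurable_subtype_coe

theorem measurable_cod : Measurable (cod : OperatorCode σ → SB) :=
  measurable_fst.comp (measurable_snd.comp measurable_subtype_coe)

theorem measurable_seq (n : ℕ) : Measurable fun T : OperatorCode σ => T.seq n :=
  (measurable_pi_apply n).comp (measurable_snd.comp (measurable_snd.comp measurable_subtype_coe))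

/-- On the Borel set where `x` lies in the domain, `T x` is the limit of `y_n` along indices `n`
with `d_n(X)` tending to `x`. Taking the least index within `1 / (j + 1)` makes the choice Borel in
`(T, x)`. -/
theorem measurable_eval : Measurable fun p : OperatorCode σ × CantorC => p.1.eval p.2 := by
  classical
  have hdom : MeasurableSet {p : OperatorCode σ × CantorC | p.2 ∈ p.1.dom} :=
    SB.measurableSet_mem.preimage (measurable_snd.prodMk (measurable_dom.comp measurable_fst))
  -- The first alternative makes the search for `n` succeed for every pair, so that `Nat.find` is
  -- defined everywhere.
  have hex (j : ℕ) (p : OperatorCode σ × CantorC) :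
      ∃ n, p.2 ∉ p.1.dom ∨ dist p.2 (σ.d n p.1.dom) < 1 / ((j : ℝ) + 1) := by
    by_cases h : p.2 ∈ p.1.dom
    · obtain ⟨_, ⟨n, rfl⟩, hn⟩ := Metric.mem_closure_iff.1 (σ.dense_d _ h) (1 / ((j : ℝ) + 1))
        (by positivity)
      exact ⟨n, .inr hn⟩
    · exact ⟨0, .inl h⟩
  have hfind (j : ℕ) : Measurable fun p => Nat.find (hex j p) :=
    measurable_find (hex j) fun n => hdom.compl.union (measurableSet_lt
      (measurable_snd.dist ((σ.measurable_d n).comp (measurable_dom.comp measurable_fst)))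
      measurable_const)
  have hseq : Measurable fun q : OperatorCode σ × ℕ => q.1.seq q.2 :=
    measurable_from_prod_countable_left fun n => measurable_seq n
  refine measurable_of_tendsto_metrizable
    (f := fun j p => if p.2 ∈ p.1.dom then p.1.seq (Nat.find (hex j p)) else 0)
    (fun j => Measurable.ite hdom (hseq.comp (measurable_fst.prodMk (hfind j))) measurable_const)
    (tendsto_pi_nhds.2 fun p => ?_)
  by_cases h : p.2 ∈ p.1.dom
  · simp only [if_pos h]
    rw [p.1.eval_of_mem h]
    simp only [← op_apply]
    refine ((continuous_subtype_val.comp p.1.op.continuous).tendsto ⟨p.2, h⟩).comp ?_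
    rw [tendsto_subtype_rng]
    refine tendsto_iff_dist_tendsto_zero.2 (squeeze_zero (fun _ => dist_nonneg) (fun j => ?_)
      tendsto_one_div_add_atTop_nhds_zero_nat)
    rw [dist_comm]
    exact ((Nat.find_spec (hex j p)).resolve_left (not_not_intro h)).le
  · simp only [if_neg h]
    rw [eval, dif_neg (show p.2 ∉ p.1.dom.toSubmodule from h)]
    exact tendsto_const_nhds

/-! ### The Borel relation of factorization -/

/-- The codes `C` and `D` witness that `A` factors through the restriction of `B` with values in
the domain of `D`. -/
structure IsFactorization (A B C D : OperatorCode σ) : Prop where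
  dom_left : C.dom = A.dom
  cod_left : C.cod = B.dom
  cod_right : D.cod = A.cod
  dom_right : D.dom ≤ B.cod
  eval_mem : ∀ n, B.eval (C.seq n) ∈ D.dom
  seq_eq : ∀ n, A.seq n = D.eval (B.eval (C.seq n))

/-- The inclusion `D.dom ≤ B.cod` is the only clause that is not visibly a countable conjunction of
Borel conditions. Since `B.cod` is closed, it can be tested on the dense sequence of `D.dom`. -/
theorem measurableSet_isFactorization :
    MeasurableSet {p : (OperatorCode σ × OperatorCode σ) × OperatorCode σ × OperatorCode σ |
      IsFactorization p.1.1 p.1.2 p.2.1 p.2.2} := by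
  have hd := measurable_dom (σ := σ)
  have hc := measurable_cod (σ := σ)
  have hs := measurable_seq (σ := σ)
  have he := measurable_eval (σ := σ)
  let P := (OperatorCode σ × OperatorCode σ) × OperatorCode σ × OperatorCode σ
  have hev (n : ℕ) : Measurable fun p : P => p.1.2.eval (p.2.1.seq n) :=
    he.comp (f := fun p : P => (p.1.2, p.2.1.seq n)) (by fun_prop)
  have : {p : P | IsFactorization p.1.1 p.1.2 p.2.1 p.2.2} =
      {p | p.2.1.dom = p.1.1.dom} ∩ {p | p.2.1.cod = p.1.2.dom} ∩
      {p | p.2.2.cod = p.1.1.cod} ∩ (⋂ n, {p | σ.d n p.2.2.dom ∈ p.1.2.cod}) ∩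
      (⋂ n, {p | p.1.2.eval (p.2.1.seq n) ∈ p.2.2.dom}) ∩
      ⋂ n, {p | p.1.1.seq n = p.2.2.eval (p.1.2.eval (p.2.1.seq n))} := by
    ext p
    simp only [mem_inter_iff, mem_iInter, mem_ofPred_eq]
    constructor
    · rintro ⟨h1, h2, h3, h4, h5, h6⟩
      exact ⟨⟨⟨⟨⟨h1, h2⟩, h3⟩, fun n => h4 (σ.d_mem n _)⟩, h5⟩, h6⟩
    · rintro ⟨⟨⟨⟨⟨h1, h2⟩, h3⟩, h4⟩, h5⟩, h6⟩
      refine ⟨h1, h2, h3, fun x hx => ?_, h5, h6⟩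
      exact p.1.2.cod.isClosed.closure_subset_iff.2 (range_subset_iff.2 h4) (σ.dense_d _ hx)
  change MeasurableSet {p : P | IsFactorization p.1.1 p.1.2 p.2.1 p.2.2}
  rw [this]
  refine (((((measurableSet_eq_fun ?_ ?_).inter (measurableSet_eq_fun ?_ ?_)).inter
    (measurableSet_eq_fun ?_ ?_)).inter (.iInter fun n => ?_)).inter (.iInter fun n => ?_)).inter
    (.iInter fun n => ?_)
  iterate 6 fun_prop
  · exact SB.measurableSet_mem.preimage
      (((σ.measurable_d n).comp (hd.comp (measurable_snd.comp measurable_snd))).prodMk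
        (hc.comp (measurable_snd.comp measurable_fst)))
  · exact SB.measurableSet_mem.preimage
      ((hev n).prodMk (hd.comp (measurable_snd.comp measurable_snd)))
  · exact measurableSet_eq_fun ((hs n).comp (measurable_fst.comp measurable_fst))
      (he.comp ((measurable_snd.comp measurable_snd).prodMk (hev n)))

/-- The operator of a code, between subspaces known to be its domain and codomain. -/
theorem exists_clm (T : OperatorCode σ) {X Y : SB} (hX : T.dom = X) (hY : T.cod = Y) :
    ∃ f : X.toSubmodule →L[ℝ] Y.toSubmodule, ∀ x : X.toSubmodule, (f x : CantorC) = T.eval x := by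
  subst hX hY
  exact ⟨T.op, fun x => (T.eval_coe x).symm⟩

theorem clm_ext {X Y : SB} {f g : X.toSubmodule →L[ℝ] Y.toSubmodule}
    (h : ∀ n, (f ⟨σ.d n X, σ.d_mem n X⟩ : CantorC) = g ⟨σ.d n X, σ.d_mem n X⟩) : f = g := by
  refine ContinuousLinearMap.ext fun x => congrFun
    ((denseRange_dom σ X).equalizer f.continuous g.continuous (funext fun n => ?_)) x
  exact Subtype.ext (h n)

theorem seq_eq_eval (T : OperatorCode σ) (n : ℕ) : T.seq n = T.eval (σ.d n T.dom) := by
  rw [T.eval_of_mem (σ.d_mem n T.dom), op_apply]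

/-- With `D` defined on all of `B.cod`, the membership clause holds automatically, and agreement on
the dense sequence of `A.dom` gives `A = DBC`. -/
theorem factorsThrough_iff (A B : OperatorCode σ) :
    FactorsThrough (X := A.dom.toSubmodule) (Y := A.cod.toSubmodule) (Z := B.dom.toSubmodule)
        (W := B.cod.toSubmodule) A.op B.op ↔ ∃ C D, IsFactorization A B C D ∧ D.dom = B.cod := by
  constructor
  · rintro ⟨C, D, h⟩
    have hev (n : ℕ) : B.eval ((ofCLM σ C).seq n) = B.op (C ⟨σ.d n A.dom, σ.d_mem n A.dom⟩) :=
      B.eval_coe _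
    refine ⟨ofCLM σ C, ofCLM σ D, ⟨rfl, rfl, rfl, le_rfl, fun n => ?_, fun n => ?_⟩, rfl⟩
    · rw [hev]
      exact (B.op _).2
    · rw [hev, ← op_apply, h]
      refine Eq.trans ?_ ((ofCLM σ D).eval_coe _).symm
      rw [op_ofCLM]
      rfl
  · rintro ⟨C, D, h, hD⟩
    obtain ⟨c, hc⟩ := C.exists_clm h.dom_left h.cod_left
    obtain ⟨d, hd⟩ := D.exists_clm hD h.cod_right
    refine ⟨c, d, clm_ext (σ := σ) fun n => ?_⟩
    rw [op_apply, h.seq_eq, C.seq_eq_eval, h.dom_left]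
    change _ = (d (B.op (c _)) : CantorC)
    rw [hd, ← eval_coe, hc]

theorem factorsThroughRestriction_iff (A B : OperatorCode σ) :
    FactorsThroughRestriction (X := A.dom.toSubmodule) (Y := A.cod.toSubmodule) (Z := B.dom.toSubmodule)
        (W := B.cod.toSubmodule) A.op B.op ↔ ∃ C D, IsFactorization A B C D := by
  constructor
  · rintro ⟨Z₁, W₁, hBZ, C, D, h⟩
    -- `W₁` is closed in `B.cod`, which is closed in `C(2^ℕ)`; hence its image is a point of `SB`
    -- and can be the domain of a code.
    have hcl : IsClosed ((W₁.toSubmodule.map B.cod.toSubmodule.subtype : Submodule ℝ CantorC) :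
        Set CantorC) := by
      rw [Submodule.map_coe]
      exact B.cod.isClosed.isClosedEmbedding_subtypeVal.isClosedMap _ W₁.isClosed
    let V : SB := ⟨W₁.toSubmodule.map B.cod.toSubmodule.subtype, hcl⟩
    have hV : ∀ v ∈ V, ∃ h : v ∈ B.cod.toSubmodule, ⟨v, h⟩ ∈ W₁.toSubmodule := by
      rintro _ ⟨w, hw, rfl⟩
      exact ⟨w.2, hw⟩
    let i : V.toSubmodule →L[ℝ] B.cod.toSubmodule :=
      V.toSubmodule.subtypeL.codRestrict _ fun v => (hV v v.2).1
    let j : V.toSubmodule →L[ℝ] W₁.toSubmodule := i.codRestrict _ fun v => (hV v v.2).2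
    let c : A.dom.toSubmodule →L[ℝ] B.dom.toSubmodule := Z₁.toSubmodule.subtypeL.comp C
    let d : V.toSubmodule →L[ℝ] A.cod.toSubmodule := D.comp j
    have hev (n : ℕ) : B.eval ((ofCLM σ c).seq n) = B.op (c ⟨σ.d n A.dom, σ.d_mem n A.dom⟩) :=
      B.eval_coe _
    have hmem (n : ℕ) : (B.op (c ⟨σ.d n A.dom, σ.d_mem n A.dom⟩) : CantorC) ∈ V.toSubmodule :=
      Submodule.mem_map_of_mem (hBZ _ (C _).2)
    refine ⟨ofCLM σ c, ofCLM σ d, rfl, rfl, rfl, fun v hv => (hV v hv).1, fun n => ?_, fun n => ?_⟩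
    · rw [hev]
      exact hmem n
    · rw [hev, ← op_apply, h]
      refine Eq.trans ?_ ((ofCLM σ d).eval_coe ⟨_, hmem n⟩).symm
      rw [op_ofCLM]
      rfl
  · rintro ⟨C, D, h⟩
    obtain ⟨c, hc⟩ := C.exists_clm h.dom_left h.cod_left
    obtain ⟨d, hd⟩ := D.exists_clm rfl h.cod_right
    -- `Z₁` is the largest subspace that `B` maps into `W₁`, so `B Z₁ ⊆ W₁` holds by definition.
    let W₁ : ClosedSubmodule ℝ B.cod.toSubmodule := D.dom.comap B.cod.toSubmodule.subtypeL
    let Z₁ : ClosedSubmodule ℝ B.dom.toSubmodule := W₁.comap B.op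
    have hcn (n : ℕ) : (c ⟨σ.d n A.dom, σ.d_mem n A.dom⟩ : CantorC) = C.seq n := by
      rw [hc, C.seq_eq_eval, h.dom_left]
    -- `Z₁` is closed, so the membership known at the vectors `d_n` passes to all of `A.dom`.
    have hcZ (x : A.dom.toSubmodule) : c x ∈ Z₁.toSubmodule := by
      refine (denseRange_dom σ A.dom).induction_on (p := fun x => c x ∈ Z₁.toSubmodule) x
        (Z₁.isClosed.preimage c.continuous) fun n => ?_
      change (B.op (c _) : CantorC) ∈ D.dom
      rw [← eval_coe, hcn]
      exact h.eval_mem n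
    let i : W₁.toSubmodule →L[ℝ] D.dom.toSubmodule :=
      (B.cod.toSubmodule.subtypeL.comp W₁.toSubmodule.subtypeL).codRestrict _ fun w => w.2
    refine ⟨Z₁, W₁, fun z hz => hz, c.codRestrict _ hcZ, d.comp i, clm_ext (σ := σ) fun n => ?_⟩
    rw [op_apply, h.seq_eq]
    change _ = (d (i _) : CantorC)
    rw [hd]
    change _ = D.eval (B.op (c _))
    rw [← eval_coe, hcn]

end OperatorCode

/-! ### Projection and the four sets -/

/-- The projection of a Borel set is analytic. -/
theorem isAnalytic_exists {S T : Type} [MeasurableSpace S] [StandardBorelSpace S]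
    [MeasurableSpace T] [StandardBorelSpace T] {R : S → T → Prop}
    (hR : MeasurableSet {p : S × T | R p.1 p.2}) : IsAnalytic {s | ∃ t, R s t} := by
  refine ⟨S × T, inferInstance, inferInstance, _, Prod.fst, hR, measurable_fst, ?_⟩
  ext s
  simp

end

theorem mainTheorem5 (σ : DenseSelection) (𝓑 : Set (OperatorCode σ)) (h𝓑 : MeasurableSet 𝓑) :
    IsAnalytic {A : OperatorCode σ | ∃ B ∈ 𝓑, FactorsThrough A.op B.op} ∧
    IsAnalytic {A : OperatorCode σ | ∃ B ∈ 𝓑, FactorsThrough B.op A.op} ∧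
    IsAnalytic {A : OperatorCode σ | ∃ B ∈ 𝓑, FactorsThroughRestriction B.op A.op} ∧
    IsAnalytic {A : OperatorCode σ | ∃ B ∈ 𝓑, FactorsThroughRestriction A.op B.op} := by
  let L := OperatorCode σ
  have hR := OperatorCode.measurableSet_isFactorization (σ := σ)
  have hE : MeasurableSet {p : (L × L) × L × L | p.2.2.dom = p.1.2.cod} :=
    measurableSet_eq_fun (OperatorCode.measurable_dom.comp (measurable_snd.comp measurable_snd))
      (OperatorCode.measurable_cod.comp (measurable_snd.comp measurable_fst))
  have hB : MeasurableSet {p : L × L × L × L | p.2.1 ∈ 𝓑} :=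
    h𝓑.preimage (measurable_fst.comp measurable_snd)
  -- The first coordinate is the operator `A` of the set in question, the second is `B ∈ 𝓑`, and the
  -- last two are `C` and `D`. `hf` serves the sets where `A` factors through `B`; `hg` exchanges
  -- the two roles.
  have hf : Measurable fun p : L × L × L × L => ((p.1, p.2.1), p.2.2) := by fun_prop
  have hg : Measurable fun p : L × L × L × L => ((p.2.1, p.1), p.2.2) := by fun_prop
  refine ⟨?_, ?_, ?_, ?_⟩
  · convert isAnalytic_exists (R := fun (A : L) (q : L × L × L) =>
      q.1 ∈ 𝓑 ∧ A.IsFactorization q.1 q.2.1 q.2.2 ∧ q.2.2.dom = q.1.cod)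
      (hB.inter ((hR.inter hE).preimage hf)) using 3
    simp only [Prod.exists, exists_and_left]
    exact exists_congr fun B => and_congr_right fun _ => OperatorCode.factorsThrough_iff _ _
  · convert isAnalytic_exists (R := fun (A : L) (q : L × L × L) =>
      q.1 ∈ 𝓑 ∧ q.1.IsFactorization A q.2.1 q.2.2 ∧ q.2.2.dom = A.cod)
      (hB.inter ((hR.inter hE).preimage hg)) using 3
    simp only [Prod.exists, exists_and_left]
    exact exists_congr fun B => and_congr_right fun _ => OperatorCode.factorsThrough_iff _ _
  · convert isAnalytic_exists (R := fun (A : L) (q : L × L × L) =>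
      q.1 ∈ 𝓑 ∧ q.1.IsFactorization A q.2.1 q.2.2) (hB.inter (hR.preimage hg)) using 3
    simp only [Prod.exists, exists_and_left]
    exact exists_congr fun B => and_congr_right fun _ => OperatorCode.factorsThroughRestriction_iff _ _
  · convert isAnalytic_exists (R := fun (A : L) (q : L × L × L) =>
      q.1 ∈ 𝓑 ∧ A.IsFactorization q.1 q.2.1 q.2.2) (hB.inter (hR.preimage hf)) using 3
    simp only [Prod.exists, exists_and_left]
    exact exists_congr fun B => and_congr_right fun _ => OperatorCode.factorsThroughRestriction_iff _ _
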